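/- Let $n\in\mathbb{N}$ and let $\|\cdot\|$ denote the Frobenius norm on $\mathbb{R}^{n\times n}$. Call a function $w:\mathbb{R}^{n\times n}\to\mathbb{R}\cup\{+\infty\}$ quasiconvex if $$\int_\Omega w(F+\nabla\vartheta(x))\,dx\;\ge\;|\Omega|\,w(F)$$ for every bounded open set $\Omega\subset\mathbb{R}^n$ with $|\partial\Omega|=0$, every $F\in\mathbb{R}^{n\times n}$ and every $\vartheta\in W_0^{1,\infty}(\Omega;\mathbb{R}^n)=W^{1,\infty}(\Omega;\mathbb{R}^n)\cap W_0^{1,1}(\Omega;\mathbb{R}^n)$ for which the integral exists in $[-\infty,+\infty]$. The quasiconvex envelope (without determinant constraint) of $W:\mathbb{R}^{n\times n}\to\mathbb{R}$ is $$QW(F)=\sup\{\,w(F)\;:\;w:\mathbb{R}^{n\times n}\to\mathbb{R}\cup\{+\infty\}\text{ quasiconvex},\ w\le W\,\}.$$ Proposition. The quasiconvex envelope of the Biot energy $$W_{\mathrm{Biot}}:\mathbb{R}^{n\times n}\to\mathbb{R},\qquad W_{\mathrm{Biot}}(F)=\big\|\sqrt{F^TF}-\mathbb{1}_n\big\|^2,$$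 is given by $$QW_{\mathrm{Biot}}(F)=\sum_{k=1}^n[\lambda_k-1]_+^2,\qquad [x]_+=\max\{x,0\},$$ for every $F\in\mathbb{R}^{n\times n}$ with singular values $\lambda_1,\dots,\lambda_n\ge 0$ (the eigenvalues of $\sqrt{F^TF}$, counted with multiplicity). -/

import Mathlib

noncomputable section

open scoped ENNReal

namespace BiotEnvelope

/-- Real `n × n` matrices. -/
abbrev Mat (n : ℕ) : Type := Matrix (Fin n) (Fin n) ℝ

/-- Euclidean `n`-space. -/
abbrev E (n : ℕ) : Type := EuclideanSpace ℝ (Fin n)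

section Energy

open scoped MatrixOrder Matrix Matrix.Norms.Frobenius

/-- The Biot energy `W(F) = ‖√(Fᵀ F) - 1‖²`, with the positive semidefinite matrix square root and
the Frobenius norm. -/
def biotEnergy {n : ℕ} (F : Mat n) : ℝ := ‖CFC.sqrt (Fᵀ * F) - 1‖ ^ 2

end Energy

/-- The singular values `λ₁ ≥ … ≥ λₙ ≥ 0` of `F` (with multiplicity), i.e. the singular values of
the linear map `x ↦ F x` on Euclidean space. -/
def singularValue {n : ℕ} (F : Mat n) (k : Fin n) : ℝ :=
  (Matrix.toEuclideanLin F).singularValues k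

section Sobolev

open MeasureTheory Filter

/-- The `j`-th partial derivative of a function on Euclidean space. -/
def partialDeriv {n : ℕ} (j : Fin n) (φ : E n → ℝ) (x : E n) : ℝ :=
  fderiv ℝ φ x (EuclideanSpace.single j 1)

/-- `φ ∈ C_c^∞(Ω)`: smooth with compact support contained in `Ω`. -/
structure IsTestFunction {n : ℕ} (Ω : Set (E n)) (φ : E n → ℝ) : Prop where
  smooth : ContDiff ℝ ((⊤ : ℕ∞) : WithTop ℕ∞) φ
  hasCompactSupport : HasCompactSupport φ
  tsupport_subset : tsupport φ ⊆ Ω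

/-- `u ∈ W^{1,p}(Ω; ℝⁿ)` and its weak gradient on `Ω` is (represented by) `G`, with the convention
`G i j = ∂_j u_i`. -/
structure HasWeakGradientLp {n : ℕ} (Ω : Set (E n)) (p : ℝ≥0∞) (u : E n → E n) (G : E n → Mat n) :
    Prop where
  memLp : ∀ i, MemLp (fun x => u x i) p (volume.restrict Ω)
  memLp_grad : ∀ i j, MemLp (fun x => G x i j) p (volume.restrict Ω)
  integral_eq : ∀ i j, ∀ φ : E n → ℝ, IsTestFunction Ω φ →
    ∫ x in Ω, u x i * partialDeriv j φ x = -∫ x in Ω, G x i j * φ x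

/-- For `u` with weak gradient `G` on `Ω`: `u ∈ W₀^{1,1}(Ω; ℝⁿ)`, i.e. `u` is the limit in
`W^{1,1}(Ω; ℝⁿ)` of a sequence of maps in `C_c^∞(Ω; ℝⁿ)`. -/
def IsLimitOfTestMaps {n : ℕ} (Ω : Set (E n)) (u : E n → E n) (G : E n → Mat n) : Prop :=
  ∃ φ : ℕ → E n → E n,
    (∀ m i, IsTestFunction Ω (fun x => φ m x i)) ∧
    (∀ i, Tendsto (fun m => eLpNorm (fun x => φ m x i - u x i) 1 (volume.restrict Ω))
      atTop (nhds 0)) ∧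
    (∀ i j, Tendsto
      (fun m => eLpNorm (fun x => partialDeriv j (fun y => φ m y i) x - G x i j) 1
        (volume.restrict Ω))
      atTop (nhds 0))

/-- `u ∈ W₀^{1,∞}(Ω; ℝⁿ) = W^{1,∞}(Ω; ℝⁿ) ∩ W₀^{1,1}(Ω; ℝⁿ)` (`Ω` bounded and open), with weak
gradient `G`. -/
def IsW01Infty {n : ℕ} (Ω : Set (E n)) (u : E n → E n) (G : E n → Mat n) : Prop :=
  HasWeakGradientLp Ω ∞ u G ∧ IsLimitOfTestMaps Ω u G

/-- The integral of an extended-real function over `Ω` exists: the function is measurable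
(up to null sets) and its positive and negative parts do not both have infinite integral. -/
def IntegralExists {n : ℕ} (Ω : Set (E n)) (f : E n → EReal) : Prop :=
  AEMeasurable f (volume.restrict Ω) ∧
    ((∫⁻ x in Ω, (f x).toENNReal) ≠ ∞ ∨ (∫⁻ x in Ω, (-f x).toENNReal) ≠ ∞)

/-- The integral of an extended-real function over `Ω`, `∫ f⁺ - ∫ f⁻`; meaningful when
`IntegralExists Ω f`. -/
def extIntegral {n : ℕ} (Ω : Set (E n)) (f : E n → EReal) : EReal :=
  ((∫⁻ x in Ω, (f x).toENNReal : ℝ≥0∞) : EReal) - ((∫⁻ x in Ω, (-f x).toENNReal : ℝ≥0∞) : EReal)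

/-- Quasiconvexity of `w : ℝ^{n×n} → ℝ ∪ {+∞}`: for every bounded open `Ω` with null boundary, all
`F`, and all `u ∈ W₀^{1,∞}(Ω; ℝⁿ)` for which the integral exists,
`∫_Ω w(F + ∇u) dx ≥ |Ω| w(F)`. -/
def Quasiconvex {n : ℕ} (w : Mat n → EReal) : Prop :=
  ∀ Ω : Set (E n), IsOpen Ω → Bornology.IsBounded Ω → volume (frontier Ω) = 0 →
    ∀ (F : Mat n) (u : E n → E n) (G : E n → Mat n), IsW01Infty Ω u G →
      IntegralExists Ω (fun x => w (F + G x)) →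
        ((volume Ω : ℝ≥0∞) : EReal) * w F ≤ extIntegral Ω (fun x => w (F + G x))

/-- The quasiconvex envelope of `W : ℝ^{n×n} → ℝ` over all of `ℝ^{n×n}`: the pointwise supremum of
all quasiconvex `w : ℝ^{n×n} → ℝ ∪ {+∞}` with `w ≤ W`. -/
def quasiconvexEnvelope {n : ℕ} (W : Mat n → ℝ) (F : Mat n) : EReal :=
  sSup {y : EReal | ∃ w : Mat n → EReal, (∀ A, w A ≠ ⊥) ∧ Quasiconvex w ∧
    (∀ A, w A ≤ (W A : EReal)) ∧ y = w F}

end Sobolev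

end BiotEnvelope

end

/-!
The relaxed energy `G(F) = ∑ₖ [λₖ - 1]₊²` is both a quasiconvex minorant of the Biot energy
`W(F) = ∑ₖ (λₖ - 1)²` and an upper bound for every quasiconvex minorant.

**Lower bound.** `G` is the squared Frobenius distance to the unit ball of the operator norm, hence
convex. Only the existence of a subgradient at every point is needed. It comes from a duality
argument with the singular value decomposition (`exists_subgradient_relaxedEnergy`). Since the
gradient of a map in `W₀^{1,∞}` has mean zero (`IsW01Infty.integral_grad`), integrating the
subgradient inequality gives quasiconvexity (`quasiconvex_of_exists_subgradient`), and `G ≤ W` holds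
term by term.

**Upper bound.** Let `w ≤ W` be quasiconvex. Write `F = ∑ₖ cₖ uₖ vₖᵀ` with orthonormal bases `u`,
`v`. If `|cₖ| < 1`, then `F` lies on the segment between the two matrices in which `cₖ` is
replaced by `1` and by `-1`, and this segment is parallel to the rank-one matrix `uₖ vₖᵀ`. As `w`
is convex along such segments (`Quasiconvex.le_laminate`), induction on the number of such `k`
reduces the claim to the case where `|cₖ| ≥ 1` for all `k`, in which `w(F) ≤ W(F) = ∑ₖ [|cₖ| -
1]₊²` (`Quasiconvex.svdMat_le`).

**Rank-one convexity.** No measurability of `w` is assumed, so the test maps must have gradients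
with finitely many values. They are `x ↦ h(x) a`, where `h` is the positive part of a minimum of
finitely many affine functions: a tent in direction `vₖ`, cut off with slope one at distance `R`
in the other directions (`laminateRoof`). Almost everywhere the gradient of `h` is zero or that of
an active affine piece (`fderiv_roof_of_pos`, with Rademacher's theorem). As `R → ∞` the boundary
layer takes up a vanishing fraction of the support. The domain is a ball that contains the support
of `h`, and the part outside the support contributes the same amount on both sides. That such maps
belong to `W₀^{1,∞}` is shown by mollification (`isW01Infty_directedMap`).
-/

noncomputable section

namespace BiotEnvelope

open MeasureTheory Filter Topology
open scoped ENNReal NNReal Convolution Matrix RealInnerProductSpace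

variable {n : ℕ}

/-! ### Singular value decompositions -/

/-- The matrix `∑ₖ cₖ uₖ vₖᵀ`. For orthonormal bases `u`, `v` this is a singular value decomposition
with signed singular values `c`. -/
def svdMat {n : ℕ} (u v : Fin n → E n) (c : Fin n → ℝ) : Mat n :=
  Matrix.of fun i j => ∑ k, c k * u k i * v k j

/-- The bilinear form `aᵀ Y b`. -/
def bilin {n : ℕ} (Y : Mat n) (a b : E n) : ℝ := ∑ i, ∑ j, a i * Y i j * b j

/-- The Frobenius inner product of two matrices. -/
def frob {n : ℕ} (A B : Mat n) : ℝ := ∑ i, ∑ j, A i j * B i j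

theorem svdMat_apply (u v : Fin n → E n) (c : Fin n → ℝ) (i j : Fin n) :
    svdMat u v c i j = ∑ k, c k * u k i * v k j := rfl

theorem svdMat_sub (u v : Fin n → E n) (c d : Fin n → ℝ) :
    svdMat u v c - svdMat u v d = svdMat u v (fun k => c k - d k) := by
  ext i j
  simp [svdMat_apply, sub_mul, Finset.sum_sub_distrib]

theorem real_inner_eq_sum (a b : E n) : ⟪a, b⟫ = ∑ i, a i * b i := by
  simp [PiLp.inner_apply, mul_comm]

theorem frob_svdMat_left (u v : Fin n → E n) (c : Fin n → ℝ) (Y : Mat n) :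
    frob (svdMat u v c) Y = ∑ k, c k * bilin Y (u k) (v k) := by
  simp only [frob, bilin, svdMat_apply, Finset.sum_mul, Finset.mul_sum]
  rw [Finset.sum_comm' (t' := Finset.univ) (s' := fun _ => Finset.univ) (by simp)]
  rw [Finset.sum_congr rfl fun j _ => Finset.sum_comm, Finset.sum_comm]
  refine Finset.sum_congr rfl fun k _ => ?_
  rw [Finset.sum_comm]
  refine Finset.sum_congr rfl fun i _ => Finset.sum_congr rfl fun j _ => by ring

theorem bilin_svdMat (u v : Fin n → E n) (c : Fin n → ℝ) (a b : E n) :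
    bilin (svdMat u v c) a b = ∑ k, c k * ⟪u k, a⟫ * ⟪v k, b⟫ := by
  simp only [bilin, svdMat_apply, real_inner_eq_sum, Finset.sum_mul, Finset.mul_sum]
  rw [Finset.sum_congr rfl fun j _ => Finset.sum_comm, Finset.sum_comm]
  refine Finset.sum_congr rfl fun k _ => ?_
  rw [Finset.sum_comm]
  refine Finset.sum_congr rfl fun i _ => Finset.sum_congr rfl fun j _ => by ring

theorem bilin_svdMat_self (u v : OrthonormalBasis (Fin n) ℝ (E n)) (c : Fin n → ℝ) (k : Fin n) :
    bilin (svdMat u v c) (u k) (v k) = c k := by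
  rw [bilin_svdMat, Finset.sum_eq_single k]
  · simp
  · intro l _ hl
    simp [u.inner_eq_ite, hl]
  · simp

theorem frob_svdMat_self (u v : OrthonormalBasis (Fin n) ℝ (E n)) (c d : Fin n → ℝ) :
    frob (svdMat u v c) (svdMat u v d) = ∑ k, c k * d k := by
  rw [frob_svdMat_left]
  simp only [bilin_svdMat_self]

/-- A matrix whose singular values are at most one is a contraction. -/
theorem abs_bilin_svdMat_le_one (u v : OrthonormalBasis (Fin n) ℝ (E n)) {c : Fin n → ℝ}
    (hc : ∀ k, |c k| ≤ 1) {a b : E n} (ha : ‖a‖ = 1) (hb : ‖b‖ = 1) :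
    |bilin (svdMat u v c) a b| ≤ 1 := by
  rw [bilin_svdMat]
  have h1 : ∑ k, ⟪u k, a⟫ ^ 2 = 1 := by
    have := u.sum_sq_norm_inner_right a
    simpa [ha] using this
  have h2 : ∑ k, ⟪v k, b⟫ ^ 2 = 1 := by
    have := v.sum_sq_norm_inner_right b
    simpa [hb] using this
  calc |∑ k, c k * ⟪u k, a⟫ * ⟪v k, b⟫|
      ≤ ∑ k, |c k * ⟪u k, a⟫ * ⟪v k, b⟫| := Finset.abs_sum_le_sum_abs _ _
    _ ≤ ∑ k, (⟪u k, a⟫ ^ 2 + ⟪v k, b⟫ ^ 2) / 2 := by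
        refine Finset.sum_le_sum fun k _ => ?_
        rw [abs_mul, abs_mul, ← sq_abs ⟪u k, a⟫, ← sq_abs ⟪v k, b⟫]
        have := mul_le_mul_of_nonneg_right (hc k)
          (mul_nonneg (abs_nonneg ⟪u k, a⟫) (abs_nonneg ⟪v k, b⟫))
        nlinarith [sq_nonneg (|⟪u k, a⟫| - |⟪v k, b⟫|)]
    _ = 1 := by
        rw [← Finset.sum_div, Finset.sum_add_distrib, h1, h2]; norm_num

theorem frob_sub_right (A B C : Mat n) : frob A (B - C) = frob A B - frob A C := by
  simp [frob, mul_sub, Finset.sum_sub_distrib]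

theorem two_mul_frob_le (A B : Mat n) : 2 * frob A B ≤ frob A A + frob B B := by
  simp only [frob, Finset.mul_sum, ← Finset.sum_add_distrib]
  exact Finset.sum_le_sum fun i _ => Finset.sum_le_sum fun j _ => by
    nlinarith [sq_nonneg (A i j - B i j)]

/-- Existence of a singular value decomposition: `v` diagonalises `Fᵀ F`, and the nonzero vectors
`F vₖ / λₖ` are completed to an orthonormal basis `u`. -/
theorem exists_eq_svdMat (F : Mat n) : ∃ u v : OrthonormalBasis (Fin n) ℝ (E n),
    F = svdMat u v (singularValue F) := by
  set T := Matrix.toEuclideanLin F with hT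
  have hn : Module.finrank ℝ (E n) = n := by simp
  let v := T.isSymmetric_adjoint_comp_self.eigenvectorBasis hn
  have hσ (k : Fin n) : singularValue F k ^ 2 = T.isSymmetric_adjoint_comp_self.eigenvalues hn k :=
    T.sq_singularValues_fin hn k
  have hinner (k l : Fin n) : ⟪T (v k), T (v l)⟫ = if k = l then singularValue F k ^ 2 else 0 := by
    rw [← LinearMap.adjoint_inner_right]
    have : (LinearMap.adjoint T) (T (v l)) = (singularValue F l ^ 2) • v l := by
      rw [hσ]
      exact T.isSymmetric_adjoint_comp_self.apply_eigenvectorBasis hn l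
    rw [this, inner_smul_right, v.inner_eq_ite]
    split_ifs with h
    · simp [h]
    · simp
  have horth : Pairwise fun k l => ⟪T (v k), T (v l)⟫ = 0 := fun k l h => by
    simp [hinner, h]
  have hcard : Module.finrank ℝ (E n) = Fintype.card (Fin n) := by simp
  let u := InnerProductSpace.gramSchmidtOrthonormalBasis hcard (fun k => T (v k))
  have hnorm (k : Fin n) : ‖T (v k)‖ = singularValue F k := by
    have h := hinner k k
    rw [if_pos rfl, real_inner_self_eq_norm_sq] at h
    exact (sq_eq_sq₀ (norm_nonneg _) (T.singularValues_nonneg k)).1 h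
  have hTv (k : Fin n) : T (v k) = singularValue F k • u k := by
    by_cases h : T (v k) = 0
    · rw [← hnorm, h]; simp
    · have hu : u k = (‖T (v k)‖⁻¹ : ℝ) • T (v k) :=
        InnerProductSpace.gramSchmidtOrthonormalBasis_apply_of_orthogonal hcard horth h
      rw [hu, ← hnorm, smul_smul, mul_inv_cancel₀ (norm_ne_zero_iff.2 h), one_smul]
  refine ⟨u, v, ?_⟩
  ext i j
  -- `F eⱼ = ∑ₖ ⟨vₖ, eⱼ⟩ T vₖ`
  have he : F i j = (T (EuclideanSpace.single j 1)) i := by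
    simp [hT, Matrix.toEuclideanLin, Matrix.toLpLin_apply]
  rw [he, ← v.sum_repr' (EuclideanSpace.single j 1), map_sum, svdMat_apply]
  simp only [map_smul, hTv, WithLp.ofLp_sum, Finset.sum_apply, PiLp.smul_apply, smul_eq_mul]
  refine Finset.sum_congr rfl fun k _ => ?_
  rw [EuclideanSpace.inner_single_right]
  simp
  ring

/-! ### The Biot energy in terms of singular values -/

section
open scoped MatrixOrder Matrix.Norms.Frobenius

theorem svdMat_self_one (v : OrthonormalBasis (Fin n) ℝ (E n)) :
    svdMat v v (fun _ => 1) = 1 := by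
  ext i j
  have h := v.sum_inner_mul_inner (EuclideanSpace.single i 1) (EuclideanSpace.single j 1)
  simp only [EuclideanSpace.inner_single_left, EuclideanSpace.inner_single_right] at h
  simp only [svdMat_apply, one_mul]
  simpa [Matrix.one_apply, Pi.single_apply, eq_comm] using h

theorem transpose_svdMat_mul (u v : OrthonormalBasis (Fin n) ℝ (E n)) (c : Fin n → ℝ) :
    (svdMat u v c)ᵀ * svdMat u v c = svdMat v v (fun k => c k ^ 2) := by
  ext i j
  calc ((svdMat u v c)ᵀ * svdMat u v c) i j
      = ∑ x, ∑ k, ∑ l, (c k * v k i * (c l * v l j)) * (u k x * u l x) := by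
        simp only [Matrix.mul_apply, Matrix.transpose_apply, svdMat_apply, Finset.sum_mul_sum]
        exact Finset.sum_congr rfl fun x _ => Finset.sum_congr rfl fun k _ =>
          Finset.sum_congr rfl fun l _ => by ring
    _ = ∑ k, ∑ l, (c k * v k i * (c l * v l j)) * ⟪u k, u l⟫ := by
        rw [Finset.sum_comm]
        refine Finset.sum_congr rfl fun k _ => ?_
        rw [Finset.sum_comm]
        exact Finset.sum_congr rfl fun l _ => by rw [real_inner_eq_sum, Finset.mul_sum]
    _ = svdMat v v (fun k => c k ^ 2) i j := by
        simp only [u.inner_eq_ite, mul_ite, mul_one, mul_zero, Finset.sum_ite_eq, Finset.mem_univ,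
          if_true, svdMat_apply]
        exact Finset.sum_congr rfl fun k _ => by ring

theorem posSemidef_svdMat (v : Fin n → E n) {c : Fin n → ℝ} (hc : ∀ k, 0 ≤ c k) :
    (svdMat v v c).PosSemidef := by
  have h : svdMat v v c = (Matrix.of fun i k => v k i) * Matrix.diagonal c *
      (Matrix.of fun i k => v k i)ᴴ := by
    ext i j
    simp [svdMat_apply, Matrix.mul_apply, Matrix.diagonal_apply, mul_comm]
  rw [h]
  exact (Matrix.PosSemidef.diagonal hc).mul_mul_conjTranspose_same _

theorem frobenius_norm_sq (A : Mat n) : ‖A‖ ^ 2 = frob A A := by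
  rw [Matrix.frobenius_norm_def, ← Real.sqrt_eq_rpow, Real.sq_sqrt (by positivity)]
  simp [frob, sq]

theorem biotEnergy_svdMat (u v : OrthonormalBasis (Fin n) ℝ (E n)) (c : Fin n → ℝ) :
    biotEnergy (svdMat u v c) = ∑ k, (|c k| - 1) ^ 2 := by
  have hsqrt : CFC.sqrt ((svdMat u v c)ᵀ * svdMat u v c) = svdMat v v (fun k => |c k|) := by
    have hpos := posSemidef_svdMat v (fun k => abs_nonneg (c k))
    refine CFC.sqrt_unique ?_ (Matrix.nonneg_iff_posSemidef.2 hpos)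
    have hT : (svdMat v v (fun k => |c k|))ᵀ = svdMat v v (fun k => |c k|) := hpos.isHermitian
    nth_rw 1 [← hT]
    rw [transpose_svdMat_mul, transpose_svdMat_mul]
    simp
  rw [biotEnergy, hsqrt, ← svdMat_self_one v, svdMat_sub, frobenius_norm_sq, frob_svdMat_self]
  exact Finset.sum_congr rfl fun k _ => by ring

end

/-! ### The relaxed energy -/

/-- The relaxed energy `∑ₖ [λₖ - 1]₊²`. -/
def relaxedEnergy (F : Mat n) : ℝ := ∑ k, (max (singularValue F k - 1) 0) ^ 2

theorem singularValue_nonneg (F : Mat n) (k : Fin n) : 0 ≤ singularValue F k :=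
  LinearMap.singularValues_nonneg _ _

theorem relaxedEnergy_nonneg (F : Mat n) : 0 ≤ relaxedEnergy F :=
  Finset.sum_nonneg fun _ _ => sq_nonneg _

theorem relaxedEnergy_le_biotEnergy (F : Mat n) : relaxedEnergy F ≤ biotEnergy F := by
  obtain ⟨u, v, h⟩ := exists_eq_svdMat F
  rw [relaxedEnergy, h, biotEnergy_svdMat, ← h]
  refine Finset.sum_le_sum fun k _ => ?_
  rw [abs_of_nonneg (singularValue_nonneg F k)]
  rcases max_cases (singularValue F k - 1) 0 with h | h <;> rw [h.1]
  simpa using sq_nonneg _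

/-- The relaxed energy is the squared Frobenius distance to the unit ball `K` of the operator norm.
If `S = F - P F` is the residual of the projection of `F` to `K`, then
`dist(Y, K)² ≥ 2 ⟨S, Y⟩ - 2 max_K ⟨S, ·⟩ - ‖S‖²` with equality at `Y = F`, so `2 S` is a
subgradient at `F`. -/
theorem exists_subgradient_relaxedEnergy (F : Mat n) :
    ∃ S : Mat n, ∀ Y, relaxedEnergy F + frob S (Y - F) ≤ relaxedEnergy Y := by
  obtain ⟨u, v, hF⟩ := exists_eq_svdMat F
  set s : Fin n → ℝ := fun k => max (singularValue F k - 1) 0 with hs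
  -- The dual lower bound at `Y`, with `Z` the projection of `Y` to the unit ball.
  have key (Y : Mat n) : 2 * frob (svdMat u v s) Y - 2 * ∑ k, s k - ∑ k, s k * s k
      ≤ relaxedEnergy Y := by
    obtain ⟨u', v', hY⟩ := exists_eq_svdMat Y
    set r : Fin n → ℝ := fun k => max (singularValue Y k - 1) 0 with hr
    set Z := svdMat u' v' (fun k => min (singularValue Y k) 1) with hZ
    have hYZ : Y - Z = svdMat u' v' r := by
      nth_rw 1 [hY]
      rw [hZ, svdMat_sub]
      congr 1
      ext k
      simp only [hr]
      rcases le_total (singularValue Y k) 1 with h | h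
      · rw [min_eq_left h, max_eq_right (by linarith)]; ring
      · rw [min_eq_right h, max_eq_left (by linarith)]
    have h1 := two_mul_frob_le (svdMat u v s) (Y - Z)
    rw [frob_sub_right, hYZ, frob_svdMat_self, frob_svdMat_self] at h1
    have h2 : frob (svdMat u v s) Z ≤ ∑ k, s k := by
      rw [frob_svdMat_left]
      refine Finset.sum_le_sum fun k _ => mul_le_of_le_one_right (le_max_right _ _) ?_
      refine (le_abs_self _).trans (abs_bilin_svdMat_le_one u' v' (fun l => ?_) (by simp) (by simp))
      rw [abs_of_nonneg (le_min (singularValue_nonneg Y l) zero_le_one)]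
      exact min_le_right _ _
    have h3 : relaxedEnergy Y = ∑ k, r k * r k := Finset.sum_congr rfl fun k _ => sq _
    linarith
  have hFF : 2 * frob (svdMat u v s) F - 2 * ∑ k, s k - ∑ k, s k * s k = relaxedEnergy F := by
    nth_rw 1 [hF]
    rw [frob_svdMat_self, relaxedEnergy, Finset.mul_sum, Finset.mul_sum, ← Finset.sum_sub_distrib,
      ← Finset.sum_sub_distrib]
    refine Finset.sum_congr rfl fun k _ => ?_
    simp only [hs]
    rcases max_cases (singularValue F k - 1) 0 with h | h <;> rw [h.1] <;> ring
  refine ⟨(2 : ℝ) • svdMat u v s, fun Y => ?_⟩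
  have h2 : frob ((2 : ℝ) • svdMat u v s) (Y - F) = 2 * frob (svdMat u v s) (Y - F) := by
    simp [frob, Finset.mul_sum, mul_assoc]
  rw [h2, frob_sub_right]
  linarith [key Y]

/-! ### Quasiconvexity of the relaxed energy -/

theorem IsTestFunction.integral_partialDeriv {Ω : Set (E n)} {φ : E n → ℝ}
    (hφ : IsTestFunction Ω φ) (j : Fin n) : ∫ x in Ω, partialDeriv j φ x = 0 := by
  have hd : Continuous (partialDeriv j φ) :=
    (hφ.smooth.continuous_fderiv (by simp)).clm_apply continuous_const
  have hs : HasCompactSupport (partialDeriv j φ) := hφ.hasCompactSupport.fderiv_apply ℝ _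
  have hsub : Function.support (partialDeriv j φ) ⊆ Ω :=
    (subset_tsupport _).trans ((tsupport_fderiv_apply_subset ℝ _).trans hφ.tsupport_subset)
  rw [setIntegral_eq_integral_of_forall_compl_eq_zero
    (fun x hx => Function.notMem_support.1 fun h => hx (hsub h))]
  have h := integral_mul_fderiv_eq_neg_fderiv_mul_of_integrable (μ := (volume : Measure (E n)))
    (f := fun _ => (1 : ℝ)) (g := φ) (v := EuclideanSpace.single j 1)
    (by simp) (by simpa only [one_mul] using! hd.integrable_of_hasCompactSupport hs)
    (by simpa using hφ.smooth.continuous.integrable_of_hasCompactSupport hφ.hasCompactSupport)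
    (fun x _ => by fun_prop) (fun x _ => hφ.smooth.differentiable (by simp) x)
  simpa [partialDeriv] using h

theorem IsTestFunction.integrable_partialDeriv {Ω : Set (E n)} {φ : E n → ℝ}
    (hφ : IsTestFunction Ω φ) (j : Fin n) : Integrable (partialDeriv j φ) :=
  ((hφ.smooth.continuous_fderiv (by simp)).clm_apply
    continuous_const).integrable_of_hasCompactSupport (hφ.hasCompactSupport.fderiv_apply ℝ _)

theorem IsW01Infty.integrable_grad {Ω : Set (E n)} (hΩ : Bornology.IsBounded Ω) {u : E n → E n}
    {G : E n → Mat n} (h : IsW01Infty Ω u G) (i j : Fin n) :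
    IntegrableOn (fun x => G x i j) Ω := by
  have : IsFiniteMeasure (volume.restrict Ω) := ⟨by simpa using hΩ.measure_lt_top⟩
  exact (h.1.memLp_grad i j).integrable le_top

/-- The gradient of a map with zero boundary values has mean zero. -/
theorem IsW01Infty.integral_grad {Ω : Set (E n)} (hΩ : Bornology.IsBounded Ω) {u : E n → E n}
    {G : E n → Mat n} (h : IsW01Infty Ω u G) (i j : Fin n) : ∫ x in Ω, G x i j = 0 := by
  obtain ⟨φ, hφ, -, hG⟩ := h.2
  have hlim := tendsto_integral_of_L1' (fun x => G x i j)
    (h.integrable_grad hΩ i j).aestronglyMeasurable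
    (Eventually.of_forall fun m => ((hφ m i).integrable_partialDeriv j).integrableOn) (hG i j)
  simp only [(hφ _ i).integral_partialDeriv j] at hlim
  exact tendsto_nhds_unique hlim tendsto_const_nhds

theorem ofReal_integral_le_lintegral {α : Type*} [MeasurableSpace α] {μ : Measure α} {f : α → ℝ}
    (hf : Integrable f μ) : ENNReal.ofReal (∫ x, f x ∂μ) ≤ ∫⁻ x, ENNReal.ofReal (f x) ∂μ := by
  rw [integral_eq_lintegral_pos_part_sub_lintegral_neg_part hf]
  refine (ENNReal.ofReal_le_ofReal (sub_le_self _ ENNReal.toReal_nonneg)).trans ?_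
  exact ENNReal.ofReal_toReal_le

theorem volume_mul_coe {Ω : Set (E n)} (hΩ : Bornology.IsBounded Ω) (r : ℝ) :
    ((volume Ω : ℝ≥0∞) : EReal) * (r : EReal) = ((volume.real Ω * r : ℝ) : EReal) := by
  rw [EReal.coe_mul, measureReal_def, EReal.coe_ennreal_toReal hΩ.measure_lt_top.ne]

/-- Jensen's inequality for functions with a subgradient at every point. -/
theorem quasiconvex_of_exists_subgradient {g : Mat n → ℝ} (hg : ∀ A, 0 ≤ g A)
    (hsub : ∀ F, ∃ S, ∀ Y, g F + frob S (Y - F) ≤ g Y) :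
    Quasiconvex (fun A => (g A : EReal)) := by
  intro Ω _ hb _ F u G hu _
  have : IsFiniteMeasure (volume.restrict Ω) := ⟨by simpa using hb.measure_lt_top⟩
  obtain ⟨S, hS⟩ := hsub F
  have hGint (i j : Fin n) : Integrable (fun x => S i j * G x i j) (volume.restrict Ω) :=
    (hu.integrable_grad hb i j).const_mul _
  have hfint : Integrable (fun x => frob S (G x)) (volume.restrict Ω) :=
    integrable_finsetSum _ fun i _ => integrable_finsetSum _ fun j _ => hGint i j
  have hf0 : ∫ x in Ω, frob S (G x) = 0 := by
    simp only [frob]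
    rw [integral_finsetSum _ fun i _ => integrable_finsetSum _ fun j _ => hGint i j]
    refine Finset.sum_eq_zero fun i _ => ?_
    rw [integral_finsetSum _ fun j _ => hGint i j]
    refine Finset.sum_eq_zero fun j _ => ?_
    rw [integral_const_mul, hu.integral_grad hb, mul_zero]
  have hL : ∫ x in Ω, (g F + frob S (G x)) = volume.real Ω * g F := by
    rw [integral_add (integrable_const _) hfint, hf0]
    simp
  have hneg : ∫⁻ x in Ω, (-(g (F + G x) : EReal)).toENNReal = 0 := by
    have (x : E n) : (-(g (F + G x) : EReal)).toENNReal = 0 := by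
      refine EReal.toENNReal_of_nonpos ?_
      rw [← EReal.coe_neg]
      exact_mod_cast neg_nonpos.2 (hg _)
    simp only [this, lintegral_zero]
  rw [extIntegral, hneg, volume_mul_coe hb, ← hL]
  have h1 := (ofReal_integral_le_lintegral ((integrable_const (g F)).add hfint)).trans
    (lintegral_mono (g := fun x => ENNReal.ofReal (g (F + G x))) fun x =>
      ENNReal.ofReal_le_ofReal (by simpa using hS (F + G x)))
  calc ((∫ x in Ω, (g F + frob S (G x)) : ℝ) : EReal)
      ≤ ((ENNReal.ofReal (∫ x in Ω, (g F + frob S (G x))) : ℝ≥0∞) : EReal) := by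
        rw [EReal.coe_ennreal_ofReal]
        exact_mod_cast le_max_left _ _
    _ ≤ ((∫⁻ x in Ω, ENNReal.ofReal (g (F + G x)) : ℝ≥0∞) : EReal) := by
        exact_mod_cast h1
    _ = _ := by simp

/-! ### Compactly supported Lipschitz functions have zero boundary values -/

/-- Bump functions at the origin with outer radius `δ / (m + 1)`. -/
def shrinkingBump (n : ℕ) {δ : ℝ} (hδ : 0 < δ) (m : ℕ) :
    ContDiffBump (0 : E n) where
  rIn := δ / (m + 1) / 2
  rOut := δ / (m + 1)
  rIn_pos := by positivity
  rIn_lt_rOut := half_lt_self (by positivity)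

theorem tendsto_shrinkingBump_rOut {δ : ℝ} (hδ : 0 < δ) :
    Tendsto (fun m => (shrinkingBump n hδ m).rOut) atTop (𝓝 0) :=
  by simpa [shrinkingBump, div_eq_mul_inv] using
    (tendsto_one_div_add_atTop_nhds_zero_nat (𝕜 := ℝ)).const_mul δ

/-- The mollification of `g` at scale `δ / (m + 1)`. -/
def mollify {δ : ℝ} (hδ : 0 < δ) (g : E n → ℝ) (m : ℕ) : E n → ℝ :=
  ((shrinkingBump n hδ m).normed volume) ⋆[ContinuousLinearMap.lsmul ℝ ℝ, volume] g

theorem locallyIntegrable_of_bounded {g : E n → ℝ} (hg : Measurable g) {M : ℝ}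
    (hM : ∀ x, |g x| ≤ M) : LocallyIntegrable g :=
  (memLp_top_of_bound hg.aestronglyMeasurable M
    (Eventually.of_forall hM)).locallyIntegrable le_top

theorem tendsto_eLpNorm_mollify {δ : ℝ} (hδ : 0 < δ) {g : E n → ℝ} (hg : Measurable g) {M : ℝ}
    (hM : ∀ x, |g x| ≤ M) {Ω : Set (E n)} (hΩ : Bornology.IsBounded Ω) :
    Tendsto (fun m => eLpNorm (fun x => mollify hδ g m x - g x) 1 (volume.restrict Ω))
      atTop (𝓝 0) := by
  have : IsFiniteMeasure (volume.restrict Ω) := ⟨by simpa using hΩ.measure_lt_top⟩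
  simp only [eLpNorm_one_eq_lintegral_enorm]
  have hloc := locallyIntegrable_of_bounded hg hM
  have hlim : ∀ᵐ x ∂(volume : Measure (E n)),
      Tendsto (fun m => mollify hδ g m x) atTop (𝓝 (g x)) :=
    ContDiffBump.ae_convolution_tendsto_right_of_locallyIntegrable (K := 2)
      (tendsto_shrinkingBump_rOut hδ)
      (Eventually.of_forall fun m => by simp [shrinkingBump, mul_div_cancel₀]) hloc
  have hmeas (m : ℕ) : Measurable (mollify hδ g m) :=
    ((shrinkingBump n hδ m).hasCompactSupport_normed.continuous_convolution_left _
      (shrinkingBump n hδ m).continuous_normed hloc).measurable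
  have h0 : ∫⁻ _ in Ω, (0 : ℝ≥0∞) = 0 := by simp
  rw [← h0]
  refine tendsto_lintegral_of_dominated_convergence (fun _ => ENNReal.ofReal (2 * M))
    (fun m => ((hmeas m).sub hg).enorm) (fun m => Eventually.of_forall fun x => ?_) ?_ ?_
  · change ‖mollify hδ g m x - g x‖ₑ ≤ _
    rw [Real.enorm_eq_ofReal_abs]
    refine ENNReal.ofReal_le_ofReal ?_
    rw [← Real.dist_eq]
    refine ContDiffBump.dist_normed_convolution_le hg.aestronglyMeasurable fun y _ => ?_
    rw [Real.dist_eq]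
    linarith [abs_sub (g y) (g x), hM x, hM y]
  · simpa [ENNReal.mul_eq_top] using fun _ => hΩ.measure_lt_top.ne
  · refine ae_restrict_of_ae (hlim.mono fun x hx => ?_)
    have := (hx.sub_const (g x)).enorm
    simpa using this

theorem isTestFunction_mollify {Ω : Set (E n)} {h : E n → ℝ} (hc : Continuous h)
    (hs : HasCompactSupport h) {δ : ℝ} (hδ : 0 < δ) (hsub : Metric.cthickening δ (tsupport h) ⊆ Ω)
    (m : ℕ) : IsTestFunction Ω (mollify hδ h m) where
  smooth := (shrinkingBump n hδ m).hasCompactSupport_normed.contDiff_convolution_left _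
      (shrinkingBump n hδ m).contDiff_normed hc.locallyIntegrable
  hasCompactSupport := (shrinkingBump n hδ m).hasCompactSupport_normed.convolution _ hs
  tsupport_subset := by
    refine (closure_minimal ?_ Metric.isClosed_cthickening).trans hsub
    refine (support_convolution_subset _).trans ?_
    rw [ContDiffBump.support_normed_eq]
    rintro _ ⟨a, ha, b, hb, rfl⟩
    refine Metric.mem_cthickening_of_dist_le _ b _ _ (subset_tsupport _ hb) ?_
    rw [mem_ball_zero_iff] at ha
    have : (shrinkingBump n hδ m).rOut ≤ δ :=
      div_le_self hδ.le (by linarith [Nat.cast_nonneg (α := ℝ) m])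
    simpa [dist_eq_norm] using ha.le.trans this

theorem measurable_partialDeriv (h : E n → ℝ) (j : Fin n) : Measurable (partialDeriv j h) :=
  measurable_fderiv_apply_const ℝ h _

theorem abs_partialDeriv_le_of_lipschitz {h : E n → ℝ} {C : ℝ≥0} (hh : LipschitzWith C h)
    (j : Fin n) (x : E n) : |partialDeriv j h x| ≤ C := by
  refine ((fderiv ℝ h x).le_opNorm _).trans ?_
  simpa using norm_fderiv_le_of_lipschitz ℝ hh

/-- Mollification commutes with the (almost everywhere defined) derivative of a Lipschitz
function. -/
theorem partialDeriv_mollify {h : E n → ℝ} {C : ℝ≥0} (hh : LipschitzWith C h)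
    {δ : ℝ} (hδ : 0 < δ) (m : ℕ) (j : Fin n) :
    partialDeriv j (mollify hδ h m) = mollify hδ (partialDeriv j h) m := by
  ext x
  set η := (shrinkingBump n hδ m).normed volume
  have hηc : Continuous η := (shrinkingBump n hδ m).continuous_normed
  have hηi : Integrable η := (shrinkingBump n hδ m).integrable_normed
  have hηs : HasCompactSupport η := (shrinkingBump n hδ m).hasCompactSupport_normed
  have hdiff : ∀ᵐ t ∂(volume : Measure (E n)), DifferentiableAt ℝ h (x - t) :=
    (Measure.measurePreserving_sub_left volume x).quasiMeasurePreserving.ae hh.ae_differentiableAt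
  have key := hasFDerivAt_integral_of_dominated_loc_of_lip (μ := (volume : Measure (E n)))
    (F := fun y t => η t • h (y - t)) (F' := fun t => η t • fderiv ℝ h (x - t)) (x₀ := x)
    (s := Set.univ) (bound := fun t => |η t| * C) univ_mem
    (Eventually.of_forall fun y => by
      have : Continuous fun t => η t • h (y - t) :=
        hηc.smul (hh.continuous.comp (continuous_const.sub continuous_id))
      exact this.aestronglyMeasurable)
    (Continuous.integrable_of_hasCompactSupport
      (hηc.smul (hh.continuous.comp (continuous_const.sub continuous_id))) hηs.smul_right)
    (hηc.aestronglyMeasurable.smul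
      ((measurable_fderiv ℝ h).comp (measurable_const.sub measurable_id)).aestronglyMeasurable)
    (Eventually.of_forall fun t => by
      refine LipschitzWith.lipschitzOnWith (LipschitzWith.of_dist_le_mul fun y z => ?_)
      have := hh.dist_le_mul (y - t) (z - t)
      rw [dist_sub_right] at this
      rw [dist_smul₀, Real.norm_eq_abs, Real.coe_nnabs, abs_mul, abs_abs, mul_assoc,
        abs_of_nonneg C.coe_nonneg]
      exact mul_le_mul_of_nonneg_left this (abs_nonneg _))
    (hηi.abs.mul_const _)
    (hdiff.mono fun t ht => by
      have := ht.hasFDerivAt.comp x ((hasFDerivAt_id x).sub_const t)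
      exact this.const_smul (η t))
  have h2 : HasFDerivAt (mollify hδ h m) (∫ t, η t • fderiv ℝ h (x - t)) x := key.2
  rw [partialDeriv, h2.fderiv, ContinuousLinearMap.integral_apply key.1]
  rfl

/-- The map `x ↦ h x • a`. -/
def directedMap (a : E n) (h : E n → ℝ) (x : E n) : E n := h x • a

/-- The gradient `a ⊗ ∇h` of `x ↦ h x • a`. -/
def directedGrad (a : E n) (h : E n → ℝ) (x : E n) : Mat n :=
  Matrix.of fun i j => a i * partialDeriv j h x

theorem hasWeakGradientLp_directedMap {Ω : Set (E n)} {h : E n → ℝ} {C : ℝ≥0}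
    (hh : LipschitzWith C h) (hs : HasCompactSupport h) (a : E n) :
    HasWeakGradientLp Ω ∞ (directedMap a h) (directedGrad a h) where
  memLp i := by
    obtain ⟨M, hM⟩ := hh.continuous.bounded_above_of_compact_support hs
    refine MemLp.mul_const (f := h) (memLp_top_of_bound hh.continuous.aestronglyMeasurable M
      (Eventually.of_forall hM)) (a i)
  memLp_grad i j := by
    refine MemLp.const_mul (f := partialDeriv j h) (memLp_top_of_bound
      (measurable_partialDeriv h j).aestronglyMeasurable C
      (Eventually.of_forall fun x => abs_partialDeriv_le_of_lipschitz hh j x)) (a i)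
  integral_eq i j φ hφ := by
    obtain ⟨D, hD⟩ := hφ.smooth.lipschitzWith_of_hasCompactSupport hφ.hasCompactSupport (by simp)
    have key := LipschitzWith.integral_lineDeriv_mul_eq (μ := (volume : Measure (E n))) hh hD
      hφ.hasCompactSupport (EuclideanSpace.single j 1)
    have h1 : ∫ x, lineDeriv ℝ h x (EuclideanSpace.single j 1) * φ x
        = ∫ x, partialDeriv j h x * φ x := by
      refine integral_congr_ae (hh.ae_differentiableAt.mono fun x hx => ?_)
      simp only [partialDeriv]
      rw [hx.lineDeriv_eq_fderiv]
    have h2 (x : E n) : lineDeriv ℝ φ x (-EuclideanSpace.single j 1) = -partialDeriv j φ x := by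
      rw [(hφ.smooth.differentiable (by simp) x).lineDeriv_eq_fderiv, map_neg, partialDeriv]
    have h3 : ∫ x, partialDeriv j h x * φ x = -∫ x, h x * partialDeriv j φ x := by
      rw [← h1, key, ← integral_neg]
      refine integral_congr_ae (Eventually.of_forall fun x => ?_)
      simp only [h2]
      ring
    have hφ0 (x : E n) (hx : x ∉ Ω) : φ x = 0 :=
      image_eq_zero_of_notMem_tsupport fun h => hx (hφ.tsupport_subset h)
    have hφ1 (x : E n) (hx : x ∉ Ω) : partialDeriv j φ x = 0 :=
      image_eq_zero_of_notMem_tsupport fun h =>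
        hx (hφ.tsupport_subset (tsupport_fderiv_apply_subset ℝ _ h))
    rw [setIntegral_eq_integral_of_forall_compl_eq_zero (fun x hx => by simp [hφ1 x hx]),
      setIntegral_eq_integral_of_forall_compl_eq_zero (fun x hx => by simp [hφ0 x hx])]
    have h4 (x : E n) : directedMap a h x i * partialDeriv j φ x
        = a i * (h x * partialDeriv j φ x) := by
      simp only [directedMap, PiLp.smul_apply, smul_eq_mul]; ring
    have h5 (x : E n) : directedGrad a h x i j * φ x = a i * (partialDeriv j h x * φ x) := by
      simp only [directedGrad, Matrix.of_apply]; ring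
    simp only [h4, h5]
    rw [integral_const_mul, integral_const_mul, h3]
    ring

theorem tendsto_eLpNorm_const_mul {μ : Measure (E n)} {f : ℕ → E n → ℝ}
    (hf : Tendsto (fun m => eLpNorm (f m) 1 μ) atTop (𝓝 0)) (c : ℝ) :
    Tendsto (fun m => eLpNorm (fun x => c * f m x) 1 μ) atTop (𝓝 0) := by
  have h (m : ℕ) : eLpNorm (fun x => c * f m x) 1 μ = ‖c‖ₑ * eLpNorm (f m) 1 μ :=
    eLpNorm_const_smul c (f m) 1 μ
  simp only [h]
  simpa using ENNReal.Tendsto.const_mul hf (Or.inr enorm_ne_top)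

theorem isW01Infty_directedMap {Ω : Set (E n)} (hΩ : IsOpen Ω)
    (hb : Bornology.IsBounded Ω) {h : E n → ℝ} {C : ℝ≥0} (hh : LipschitzWith C h)
    (hs : HasCompactSupport h) (hsub : tsupport h ⊆ Ω) (a : E n) :
    IsW01Infty Ω (directedMap a h) (directedGrad a h) := by
  refine ⟨hasWeakGradientLp_directedMap hh hs a, ?_⟩
  obtain ⟨δ, hδ, hδs⟩ := hs.isCompact.exists_cthickening_subset_open hΩ hsub
  have htest := isTestFunction_mollify hh.continuous hs hδ hδs
  obtain ⟨M, hM⟩ := hh.continuous.bounded_above_of_compact_support hs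
  refine ⟨fun m => directedMap a (mollify hδ h m), fun m i => ?_, fun i => ?_, fun i j => ?_⟩
  · refine ⟨(htest m).smooth.mul contDiff_const, (htest m).hasCompactSupport.mul_right, ?_⟩
    exact (tsupport_mul_subset_left).trans (htest m).tsupport_subset
  · refine (tendsto_eLpNorm_const_mul
      (tendsto_eLpNorm_mollify hδ hh.continuous.measurable hM hb) (a i)).congr fun m => ?_
    congr 1
    ext x
    simp only [directedMap, PiLp.smul_apply, smul_eq_mul]
    ring
  · refine (tendsto_eLpNorm_const_mul (tendsto_eLpNorm_mollify hδ (measurable_partialDeriv h j)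
      (abs_partialDeriv_le_of_lipschitz hh j) hb) (a i)).congr fun m => ?_
    congr 1
    ext x
    have hd : partialDeriv j (fun y => directedMap a (mollify hδ h m) y i) x
        = a i * partialDeriv j (mollify hδ h m) x := by
      simp only [partialDeriv, directedMap, PiLp.smul_apply, smul_eq_mul]
      rw [fderiv_mul_const ((htest m).smooth.differentiable (by simp) x)]
      simp
    rw [hd, partialDeriv_mollify hh]
    simp only [directedGrad, Matrix.of_apply]
    ring

/-! ### Testing quasiconvexity with piecewise affine functions -/

theorem extIntegral_coe {Ω : Set (E n)} {f : E n → ℝ} (hf : IntegrableOn f Ω) :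
    IntegralExists Ω (fun x => (f x : EReal)) ∧
      extIntegral Ω (fun x => (f x : EReal)) = ((∫ x in Ω, f x : ℝ) : EReal) := by
  have hneg (x : E n) : (-(f x : EReal)).toENNReal = ENNReal.ofReal (-f x) := by
    rw [← EReal.coe_neg, EReal.real_coe_toENNReal]
  have h1 : ∫⁻ x in Ω, ENNReal.ofReal (f x) ≠ ∞ := hf.lintegral_lt_top.ne
  have h2 : ∫⁻ x in Ω, ENNReal.ofReal (-f x) ≠ ∞ := hf.neg.lintegral_lt_top.ne
  refine ⟨⟨hf.1.aemeasurable.coe_real_ereal, Or.inl ?_⟩, ?_⟩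
  · simpa only [EReal.real_coe_toENNReal] using h1
  · rw [extIntegral, integral_eq_lintegral_pos_part_sub_lintegral_neg_part hf, EReal.coe_sub,
      EReal.coe_ennreal_toReal h1, EReal.coe_ennreal_toReal h2]
    simp only [EReal.real_coe_toENNReal, hneg]

/-- The rank-one matrix `a ⊗ L`. -/
def rankOne (a : E n) (L : E n →L[ℝ] ℝ) : Mat n :=
  Matrix.of fun i j => a i * L (EuclideanSpace.single j 1)

theorem rankOne_zero (a : E n) : rankOne a 0 = 0 := by
  ext i j
  simp [rankOne]

theorem directedGrad_eq (a : E n) (h : E n → ℝ) (x : E n) :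
    directedGrad a h x = rankOne a (fderiv ℝ h x) := rfl

/-- Quasiconvexity tested on a large ball with `x ↦ h x • a`. If `∇h` takes finitely many values,
the integrand is measurable even though nothing is assumed about the measurability of `w`. -/
theorem Quasiconvex.integral_rankOne_nonneg {w : Mat n → ℝ}
    (hw : Quasiconvex (fun A => (w A : EReal))) {h : E n → ℝ} {C : ℝ≥0} (hh : LipschitzWith C h)
    (hs : HasCompactSupport h) (a : E n) (F : Mat n) (S : Finset (Mat n))
    (hS : ∀ᵐ x, rankOne a (fderiv ℝ h x) ∈ S) :
    Integrable (fun x => w (F + rankOne a (fderiv ℝ h x)) - w F) ∧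
      0 ≤ ∫ x, (w (F + rankOne a (fderiv ℝ h x)) - w F) := by
  classical
  set f : E n → ℝ := fun x => w (F + rankOne a (fderiv ℝ h x)) - w F with hf
  obtain ⟨ρ, hρ⟩ := hs.isCompact.isBounded.subset_ball (0 : E n)
  set Ω : Set (E n) := Metric.ball 0 ρ with hΩ
  have hΩb : Bornology.IsBounded Ω := Metric.isBounded_ball
  have hΩfin : IsFiniteMeasure (volume.restrict Ω) := ⟨by simpa using hΩb.measure_lt_top⟩
  have hΩfr : volume (frontier Ω) = 0 := by
    rcases eq_or_ne ρ 0 with h0 | h0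
    · simp [hΩ, h0]
    · rw [hΩ, frontier_ball _ h0]
      exact Measure.addHaar_sphere_of_ne_zero _ _ h0
  have hf0 (x : E n) (hx : x ∉ Ω) : f x = 0 := by
    have : fderiv ℝ h x = 0 :=
      image_eq_zero_of_notMem_tsupport fun h' => hx (hρ (tsupport_fderiv_subset ℝ h'))
    simp [hf, this, rankOne_zero]
  have hset (s : Mat n) : MeasurableSet {x | rankOne a (fderiv ℝ h x) = s} := by
    have : {x | rankOne a (fderiv ℝ h x) = s}
        = ⋂ i, ⋂ j, {x | a i * partialDeriv j h x = s i j} := by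
      ext x
      simp only [Set.mem_ofPred_eq, Set.mem_iInter, ← Matrix.ext_iff]
      rfl
    rw [this]
    exact MeasurableSet.iInter fun i => MeasurableSet.iInter fun j =>
      measurableSet_eq_fun ((measurable_partialDeriv h j).const_mul _) measurable_const
  -- `w` need not be measurable, but `f` is a finite combination of indicators of level sets of
  -- `∇h`.
  have hfae : f =ᵐ[volume] fun x => ∑ s ∈ S,
      ({x | rankOne a (fderiv ℝ h x) = s} : Set (E n)).indicator (fun _ => w (F + s) - w F) x := by
    filter_upwards [hS] with x hx
    rw [Finset.sum_eq_single_of_mem _ hx]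
    · simp [hf]
    · intro s _ hs
      rw [Set.indicator_of_notMem]
      exact fun h => hs h.symm
  have hfm : AEStronglyMeasurable f volume := by
    refine AEStronglyMeasurable.congr ?_ hfae.symm
    exact (Finset.measurable_fun_sum _ fun s _ =>
      measurable_const.indicator (hset s)).aestronglyMeasurable
  have hbound : ∀ᵐ x, ‖f x‖ ≤ ∑ s ∈ S, |w (F + s) - w F| := by
    filter_upwards [hS] with x hx
    exact Finset.single_le_sum (f := fun s => |w (F + s) - w F|) (fun s _ => abs_nonneg _) hx
  have hfΩ : IntegrableOn f Ω :=
    Integrable.of_bound hfm.restrict _ (ae_restrict_of_ae hbound)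
  have hfi : Integrable f :=
    (integrableOn_iff_integrable_of_support_subset fun x hx => by
      by_contra h; exact hx (hf0 x h)).1 hfΩ
  refine ⟨hfi, ?_⟩
  rw [← setIntegral_eq_integral_of_forall_compl_eq_zero hf0]
  have hwint : IntegrableOn (fun x => w (F + directedGrad a h x)) Ω := by
    refine (hfΩ.add (integrable_const (w F))).congr (Eventually.of_forall fun x => ?_)
    simp [hf, directedGrad_eq]
  obtain ⟨he, hi⟩ := extIntegral_coe hwint
  have hq := hw Ω Metric.isOpen_ball hΩb hΩfr F _ _
    (isW01Infty_directedMap Metric.isOpen_ball hΩb hh hs hρ a) he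
  rw [hi, volume_mul_coe hΩb, EReal.coe_le_coe_iff] at hq
  have : ∫ x in Ω, f x = (∫ x in Ω, w (F + directedGrad a h x)) - volume.real Ω * w F := by
    simp only [hf, ← directedGrad_eq]
    rw [integral_sub hwint (integrable_const _)]
    simp
  linarith

section Roof

variable {ι : Type*} [Fintype ι] [Nonempty ι]

/-- The positive part of the minimum of finitely many affine functions `c p + L p`. -/
def roof (c : ι → ℝ) (L : ι → E n →L[ℝ] ℝ) (x : E n) : ℝ :=
  max 0 (Finset.univ.inf' Finset.univ_nonempty fun p => c p + L p x)

variable (c : ι → ℝ) (L : ι → E n →L[ℝ] ℝ)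

theorem roof_nonneg (x : E n) : 0 ≤ roof c L x := le_max_left _ _

theorem roof_eq_zero {x : E n} {p : ι} (h : c p + L p x ≤ 0) : roof c L x = 0 :=
  max_eq_left ((Finset.inf'_le _ (Finset.mem_univ p)).trans h)

theorem roof_le {x : E n} (hx : 0 < roof c L x) (p : ι) : roof c L x ≤ c p + L p x := by
  rw [roof, lt_max_iff] at hx
  rw [roof, max_eq_right (hx.resolve_left (lt_irrefl _)).le]
  exact Finset.inf'_le _ (Finset.mem_univ p)

theorem exists_roof_eq {x : E n} (hx : 0 < roof c L x) : ∃ p, roof c L x = c p + L p x := by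
  rw [roof, lt_max_iff] at hx
  obtain ⟨p, -, hp⟩ := Finset.exists_mem_eq_inf' Finset.univ_nonempty fun p => c p + L p x
  exact ⟨p, by rw [roof, max_eq_right (hx.resolve_left (lt_irrefl _)).le, hp]⟩

theorem roof_eq {x : E n} {p : ι} (hp : 0 ≤ c p + L p x)
    (hmin : ∀ q, c p + L p x ≤ c q + L q x) : roof c L x = c p + L p x := by
  have : (Finset.univ.inf' Finset.univ_nonempty fun p => c p + L p x) = c p + L p x :=
    le_antisymm (Finset.inf'_le _ (Finset.mem_univ p)) (Finset.le_inf' _ _ fun q _ => hmin q)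
  rw [roof, this, max_eq_right hp]

theorem lipschitzWith_roof : LipschitzWith (∑ p, ‖L p‖₊) (roof c L) := by
  refine LipschitzWith.of_le_add_mul _ fun x y => ?_
  have hnn : (0 : ℝ) ≤ ((∑ p, ‖L p‖₊ : ℝ≥0) : ℝ) * dist x y := by positivity
  refine max_le (add_nonneg (roof_nonneg c L y) hnn) ?_
  obtain ⟨p, -, hp⟩ := Finset.exists_mem_eq_inf' Finset.univ_nonempty fun p => c p + L p y
  have h1 : L p x - L p y ≤ ((∑ p, ‖L p‖₊ : ℝ≥0) : ℝ) * dist x y := by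
    rw [← map_sub, dist_eq_norm]
    refine (le_abs_self _).trans (((L p).le_opNorm _).trans ?_)
    refine mul_le_mul_of_nonneg_right ?_ (norm_nonneg _)
    exact_mod_cast Finset.single_le_sum (f := fun p => ‖L p‖₊) (fun _ _ => zero_le)
      (Finset.mem_univ p)
  have h2 : c p + L p y ≤ roof c L y := hp ▸ le_max_right _ _
  refine (Finset.inf'_le _ (Finset.mem_univ p)).trans ?_
  linarith

/-- At a point of differentiability the gradient is that of any active affine piece, since the
difference of the two functions has a local maximum there. -/
theorem fderiv_roof_of_pos {x : E n} (hd : DifferentiableAt ℝ (roof c L) x)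
    (hx : 0 < roof c L x) {p : ι} (hp : roof c L x = c p + L p x) :
    fderiv ℝ (roof c L) x = L p := by
  have hmax : IsLocalMax (fun y => roof c L y - (c p + L p y)) x := by
    filter_upwards [(lipschitzWith_roof c L).continuous.continuousAt.eventually_const_lt hx]
      with y hy
    linarith [roof_le c L hy p]
  have hder : HasFDerivAt (fun y => roof c L y - (c p + L p y)) (fderiv ℝ (roof c L) x - L p) x :=
    hd.hasFDerivAt.sub ((L p).hasFDerivAt.const_add _)
  exact sub_eq_zero.1 (hmax.hasFDerivAt_eq_zero hder)

theorem fderiv_roof_of_eq_zero {x : E n} (hx : roof c L x = 0) : fderiv ℝ (roof c L) x = 0 :=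
  IsLocalMin.fderiv_eq_zero (Eventually.of_forall fun y => hx ▸ roof_nonneg c L y)

end Roof

/-! ### Rank-one convexity of quasiconvex functions -/

/-- A box in the coordinates of an orthonormal basis, with sides `(α, β)` in direction `v k` and
`(-r, r)` in all other directions. -/
def box (v : OrthonormalBasis (Fin n) ℝ (E n)) (k : Fin n) (α β r : ℝ) : Set (E n) :=
  {x | ∀ i, ⟪v i, x⟫ ∈ if i = k then Set.Ioo α β else Set.Ioo (-r) r}

theorem box_eq_preimage (v : OrthonormalBasis (Fin n) ℝ (E n)) (k : Fin n) (α β r : ℝ) :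
    box v k α β r = v.repr ⁻¹' ((WithLp.ofLp : E n → Fin n → ℝ) ⁻¹'
      (Set.univ.pi fun i => if i = k then Set.Ioo α β else Set.Ioo (-r) r)) := by
  ext x
  simp [box, OrthonormalBasis.repr_apply_apply]

theorem measurableSet_pi_ite_Ioo (k : Fin n) (α β r : ℝ) : MeasurableSet
    (Set.univ.pi fun i : Fin n => if i = k then Set.Ioo α β else Set.Ioo (-r) r) :=
  MeasurableSet.univ_pi fun i => by split_ifs <;> exact measurableSet_Ioo

theorem measurableSet_box (v : OrthonormalBasis (Fin n) ℝ (E n)) (k : Fin n) (α β r : ℝ) :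
    MeasurableSet (box v k α β r) := by
  rw [box_eq_preimage]
  exact v.measurePreserving_repr.measurable
    ((PiLp.volume_preserving_ofLp (Fin n)).measurable (measurableSet_pi_ite_Ioo k α β r))

theorem volume_box (v : OrthonormalBasis (Fin n) ℝ (E n)) (k : Fin n) (α β r : ℝ) :
    volume (box v k α β r) = ENNReal.ofReal (β - α) * ENNReal.ofReal (2 * r) ^ (n - 1) := by
  have hm := measurableSet_pi_ite_Ioo k α β r
  rw [box_eq_preimage, v.measurePreserving_repr.measure_preimage
    ((PiLp.volume_preserving_ofLp (Fin n)).measurable hm).nullMeasurableSet,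
    (PiLp.volume_preserving_ofLp (Fin n)).measure_preimage hm.nullMeasurableSet, volume_pi_pi,
    Fintype.prod_eq_mul_prod_compl k]
  congr 1
  · simp
  · rw [Finset.prod_congr rfl (g := fun _ => ENNReal.ofReal (2 * r))]
    · simp [Finset.card_compl]
    · intro i hi
      have : i ≠ k := by simpa using hi
      rw [if_neg this, Real.volume_Ioo]
      congr 1
      ring

theorem volume_box_ne_top (v : OrthonormalBasis (Fin n) ℝ (E n)) (k : Fin n) (α β r : ℝ) :
    volume (box v k α β r) ≠ ∞ := by
  rw [volume_box]
  finiteness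

theorem volume_real_box (v : OrthonormalBasis (Fin n) ℝ (E n)) (k : Fin n) {α β r : ℝ}
    (h : α ≤ β) (hr : 0 ≤ r) : volume.real (box v k α β r) = (β - α) * (2 * r) ^ (n - 1) := by
  rw [measureReal_def, volume_box, ENNReal.toReal_mul, ENNReal.toReal_pow,
    ENNReal.toReal_ofReal (by linarith), ENNReal.toReal_ofReal (by linarith)]

/-- Slopes of the affine pieces of `laminateRoof`: in direction `v k` the two slopes `1 - t` and
`-t` of the laminate, in every other direction the slopes `±1` of the cut-off. -/
def laminateSlope (k : Fin n) (t : ℝ) (p : Fin n × Bool) : ℝ :=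
  if p.1 = k then (if p.2 then 1 - t else -t) else (if p.2 then 1 else -1)

/-- Linear parts of the affine pieces of `laminateRoof`. -/
def laminateLin (v : OrthonormalBasis (Fin n) ℝ (E n)) (k : Fin n) (t : ℝ)
    (p : Fin n × Bool) : E n →L[ℝ] ℝ :=
  laminateSlope k t p • innerSL ℝ (v p.1)

/-- Values at the origin of the affine pieces of `laminateRoof`. -/
def laminateConst (k : Fin n) (R : ℝ) (p : Fin n × Bool) : ℝ :=
  if p.1 = k then 1 else R

/-- With `yᵢ = ⟨vᵢ, x⟩`, the positive part of the minimum of the tent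
`min (1 + (1 - t) yₖ, 1 - t yₖ)` and the cut-offs `R - |yᵢ|`, `i ≠ k`. -/
def laminateRoof (v : OrthonormalBasis (Fin n) ℝ (E n)) (k : Fin n) (t R : ℝ) :
    E n → ℝ :=
  haveI : Nonempty (Fin n × Bool) := ⟨(k, true)⟩
  roof (laminateConst k R) (laminateLin v k t)

section

variable (v : OrthonormalBasis (Fin n) ℝ (E n)) (k : Fin n) {t R : ℝ}

theorem laminateLin_apply (t : ℝ) (p : Fin n × Bool) (x : E n) :
    laminateLin v k t p x = laminateSlope k t p * ⟪v p.1, x⟫ := rfl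

theorem laminateRoof_eq_zero (ht0 : 0 < t) (ht1 : t < 1) {x : E n}
    (hx : x ∉ box v k (-(1 / (1 - t))) (1 / t) R) : laminateRoof v k t R x = 0 := by
  have : Nonempty (Fin n × Bool) := ⟨(k, true)⟩
  have ht1' : 0 < 1 - t := by linarith
  suffices h : ∃ p, laminateConst k R p + laminateLin v k t p x ≤ 0 by
    obtain ⟨p, hp⟩ := h
    exact roof_eq_zero _ _ hp
  simp only [box, Set.mem_ofPred_eq, not_forall] at hx
  obtain ⟨i, hi⟩ := hx
  rcases eq_or_ne i k with rfl | hik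
  · rw [if_pos rfl, Set.mem_Ioo, not_and_or, not_lt, not_lt, ← neg_div, le_div_iff₀ ht1',
      div_le_iff₀ ht0] at hi
    rcases hi with hi | hi
    · refine ⟨(i, true), ?_⟩
      simp only [laminateConst, laminateLin_apply, laminateSlope, if_true]
      linarith
    · refine ⟨(i, false), ?_⟩
      simp only [laminateConst, laminateLin_apply, laminateSlope, if_true, Bool.false_eq_true,
        if_false]
      linarith
  · rw [if_neg hik, Set.mem_Ioo, not_and_or, not_lt, not_lt] at hi
    rcases hi with hi | hi
    · refine ⟨(i, true), ?_⟩
      simp only [laminateConst, laminateLin_apply, laminateSlope, if_true, if_neg hik]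
      linarith
    · refine ⟨(i, false), ?_⟩
      simp only [laminateConst, laminateLin_apply, laminateSlope, Bool.false_eq_true,
        if_false, if_neg hik]
      linarith

/-- Where `|yᵢ| < R - 1` for all `i ≠ k`, only the pieces in direction `v k` are active. -/
theorem fderiv_laminateRoof_of_active {b : Bool} {x : E n}
    (hpos : 0 < 1 + laminateSlope k t (k, b) * ⟪v k, x⟫)
    (hle : laminateSlope k t (k, b) * ⟪v k, x⟫ ≤ 0)
    (hle' : laminateSlope k t (k, b) * ⟪v k, x⟫ ≤ laminateSlope k t (k, !b) * ⟪v k, x⟫)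
    (hR : ∀ i ≠ k, ⟪v i, x⟫ ∈ Set.Ioo (-(R - 1)) (R - 1))
    (hd : DifferentiableAt ℝ (laminateRoof v k t R) x) :
    fderiv ℝ (laminateRoof v k t R) x = laminateLin v k t (k, b) := by
  have : Nonempty (Fin n × Bool) := ⟨(k, true)⟩
  have hval : laminateConst k R (k, b) + laminateLin v k t (k, b) x
      = 1 + laminateSlope k t (k, b) * ⟪v k, x⟫ := by
    simp [laminateConst, laminateLin_apply]
  have heq : laminateRoof v k t R x = laminateConst k R (k, b) + laminateLin v k t (k, b) x := by
    refine roof_eq _ _ (hval ▸ hpos.le) ?_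
    rintro ⟨i, b'⟩
    rw [hval]
    rcases eq_or_ne i k with rfl | hik
    · simp only [laminateConst, if_true, laminateLin_apply]
      cases b <;> cases b' <;> simp_all
    · have hi := hR i hik
      rw [Set.mem_Ioo] at hi
      cases b' <;>
      · simp only [laminateConst, laminateLin_apply, laminateSlope, if_neg hik, if_true,
          Bool.false_eq_true, if_false]
        simp only [laminateSlope, if_true] at hle
        linarith
  exact fderiv_roof_of_pos _ _ hd (by rw [← hval, ← heq] at hpos; exact hpos) heq

theorem fderiv_laminateRoof_left (ht1 : t < 1) {x : E n}
    (hx : x ∈ box v k (-(1 / (1 - t))) 0 (R - 1))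
    (hd : DifferentiableAt ℝ (laminateRoof v k t R) x) :
    fderiv ℝ (laminateRoof v k t R) x = laminateLin v k t (k, true) := by
  have ht1' : 0 < 1 - t := by linarith
  have hk := hx k
  rw [if_pos rfl, Set.mem_Ioo, ← neg_div, div_lt_iff₀ ht1'] at hk
  refine fderiv_laminateRoof_of_active v k ?_ ?_ ?_ (fun i hi => by simpa [hi] using hx i) hd
  all_goals simp only [laminateSlope, if_true, Bool.not_true, Bool.false_eq_true, if_false]
  · linarith
  · nlinarith
  · linarith

theorem fderiv_laminateRoof_right (ht0 : 0 < t) {x : E n}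
    (hx : x ∈ box v k 0 (1 / t) (R - 1))
    (hd : DifferentiableAt ℝ (laminateRoof v k t R) x) :
    fderiv ℝ (laminateRoof v k t R) x = laminateLin v k t (k, false) := by
  have hk := hx k
  rw [if_pos rfl, Set.mem_Ioo, lt_div_iff₀ ht0] at hk
  refine fderiv_laminateRoof_of_active v k ?_ ?_ ?_ (fun i hi => by simpa [hi] using hx i) hd
  all_goals simp only [laminateSlope, if_true, Bool.not_false, Bool.false_eq_true, if_false]
  · linarith
  · nlinarith
  · linarith

theorem hasCompactSupport_laminateRoof (ht0 : 0 < t) (ht1 : t < 1) :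
    HasCompactSupport (laminateRoof v k t R) := by
  set M : ℝ := max (max (1 / (1 - t)) (1 / t)) R
  refine HasCompactSupport.intro (isCompact_closedBall (0 : E n) (∑ _i : Fin n, M)) fun x hx => ?_
  refine laminateRoof_eq_zero v k ht0 ht1 fun hbox => hx ?_
  rw [mem_closedBall_zero_iff]
  calc ‖x‖ = ‖∑ i, ⟪v i, x⟫ • v i‖ := by rw [v.sum_repr']
    _ ≤ ∑ i, ‖⟪v i, x⟫ • v i‖ := norm_sum_le _ _
    _ ≤ ∑ _i : Fin n, M := by
      refine Finset.sum_le_sum fun i _ => ?_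
      rw [norm_smul, v.norm_eq_one, mul_one, Real.norm_eq_abs, abs_le]
      have hi := hbox i
      have h1 : 1 / (1 - t) ≤ M := (le_max_left _ _).trans (le_max_left _ _)
      have h2 : 1 / t ≤ M := (le_max_right _ _).trans (le_max_left _ _)
      have h3 : R ≤ M := le_max_right _ _
      split_ifs at hi <;> rw [Set.mem_Ioo] at hi <;> constructor <;> linarith

/-- The inequality obtained from `laminateRoof` with cut-off at `R`: on the two parts of the box
where the laminate gradients are attained the integrand is explicit, and on the boundary layer it
is at most a constant independent of `R`. -/
theorem Quasiconvex.laminate_inequality {w : Mat n → ℝ}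
    (hw : Quasiconvex (fun A => (w A : EReal))) (a : E n) (F : Mat n) (ht0 : 0 < t) (ht1 : t < 1) :
    ∃ C : ℝ, ∀ R : ℝ, 1 ≤ R →
      0 ≤ (t * (w (F + rankOne a (laminateLin v k t (k, true))) - w F - C) +
        (1 - t) * (w (F + rankOne a (laminateLin v k t (k, false))) - w F - C)) *
          ((R - 1) / R) ^ (n - 1) + C := by
  classical
  have : Nonempty (Fin n × Bool) := ⟨(k, true)⟩
  have ht1' : 0 < 1 - t := by linarith
  set S : Finset (Mat n) :=
    insert 0 (Finset.univ.image fun p => rankOne a (laminateLin v k t p))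
  set C : ℝ := ∑ s ∈ S, |w (F + s) - w F|
  refine ⟨C, fun R hR => ?_⟩
  set h := laminateRoof v k t R
  have hlip : LipschitzWith _ h := lipschitzWith_roof _ _
  have hS : ∀ᵐ x, rankOne a (fderiv ℝ h x) ∈ S := by
    filter_upwards [hlip.ae_differentiableAt] with x hd
    rcases (roof_nonneg _ _ x : 0 ≤ h x).eq_or_lt with h0 | h0
    · have : fderiv ℝ h x = 0 := fderiv_roof_of_eq_zero _ _ h0.symm
      rw [this, rankOne_zero]
      exact Finset.mem_insert_self _ _
    · obtain ⟨p, hp⟩ := exists_roof_eq _ _ h0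
      have : fderiv ℝ h x = laminateLin v k t p := fderiv_roof_of_pos _ _ hd h0 hp
      rw [this]
      exact Finset.mem_insert_of_mem (Finset.mem_image_of_mem _ (Finset.mem_univ _))
  obtain ⟨hint, hnn⟩ := Quasiconvex.integral_rankOne_nonneg hw hlip
    (hasCompactSupport_laminateRoof v k ht0 ht1) a F S hS
  set f : E n → ℝ := fun x => w (F + rankOne a (fderiv ℝ h x)) - w F with hf
  set α := w (F + rankOne a (laminateLin v k t (k, true))) - w F
  set β := w (F + rankOne a (laminateLin v k t (k, false))) - w F
  set Q := box v k (-(1 / (1 - t))) (1 / t) R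
  set A := box v k (-(1 / (1 - t))) 0 (R - 1)
  set B := box v k 0 (1 / t) (R - 1)
  have hsub {α' β' : ℝ} (h1 : -(1 / (1 - t)) ≤ α') (h2 : β' ≤ 1 / t) :
      box v k α' β' (R - 1) ⊆ Q := fun x hx i => by
    have hi := hx i
    split_ifs at hi ⊢ <;> rw [Set.mem_Ioo] at hi ⊢ <;> constructor <;> linarith
  have hAQ : A ⊆ Q := hsub le_rfl (by positivity)
  have hBQ : B ⊆ Q := hsub (neg_nonpos.2 (by positivity)) le_rfl
  have hAB (x : E n) (hxA : x ∈ A) (hxB : x ∈ B) : False := by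
    have h1 := hxA k
    have h2 := hxB k
    rw [if_pos rfl, Set.mem_Ioo] at h1 h2
    linarith
  -- `A` and `B` carry the two laminate gradients and `Q ∖ (A ∪ B)` is the boundary layer.
  have hle : ∀ᵐ x, f x ≤ A.indicator (fun _ => α - C) x + B.indicator (fun _ => β - C) x +
      Q.indicator (fun _ => C) x := by
    filter_upwards [hlip.ae_differentiableAt, hS] with x hd hxS
    have hC : f x ≤ C := (le_abs_self _).trans
      (Finset.single_le_sum (f := fun s => |w (F + s) - w F|) (fun s _ => abs_nonneg _) hxS)
    by_cases hxQ : x ∈ Q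
    · by_cases hxA : x ∈ A
      · have hxB : x ∉ B := hAB x hxA
        simp only [hf, fderiv_laminateRoof_left v k ht1 hxA hd, h, Set.indicator_of_mem hxA,
          Set.indicator_of_mem hxQ, Set.indicator_of_notMem hxB]
        linarith
      · by_cases hxB : x ∈ B
        · simp only [hf, fderiv_laminateRoof_right v k ht0 hxB hd, h, Set.indicator_of_mem hxB,
            Set.indicator_of_mem hxQ, Set.indicator_of_notMem hxA]
          linarith
        · simpa [hxA, hxB, hxQ] using hC
    · have h0 : fderiv ℝ h x = 0 :=
        fderiv_roof_of_eq_zero _ _ (laminateRoof_eq_zero v k ht0 ht1 hxQ)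
      have hxA : x ∉ A := fun h => hxQ (hAQ h)
      have hxB : x ∉ B := fun h => hxQ (hBQ h)
      simp [hf, h0, rankOne_zero, hxA, hxB, hxQ]
  have hi (α' β' r c : ℝ) : Integrable ((box v k α' β' r).indicator fun _ => c) :=
    (integrable_indicator_iff (measurableSet_box v k _ _ _)).2
      (integrableOn_const (volume_box_ne_top v k _ _ _))
  have hI (α' β' r c : ℝ) : ∫ x, (box v k α' β' r).indicator (fun _ => c) x
      = volume.real (box v k α' β' r) * c := by
    rw [integral_indicator (measurableSet_box v k _ _ _), setIntegral_const, smul_eq_mul]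
  have hmono : 0 ≤ ∫ x, ((A.indicator fun _ => α - C) + (B.indicator fun _ => β - C) +
      Q.indicator fun _ => C) x :=
    hnn.trans (integral_mono_ae hint (((hi _ _ _ _).add (hi _ _ _ _)).add (hi _ _ _ _)) hle)
  rw [integral_add' ((hi _ _ _ _).add (hi _ _ _ _)) (hi _ _ _ _),
    integral_add' (hi _ _ _ _) (hi _ _ _ _), hI, hI, hI] at hmono
  have hpos1 : 0 < 1 / (1 - t) := by positivity
  have hpos2 : 0 < 1 / t := by positivity
  rw [volume_real_box v k (by linarith) (by linarith), volume_real_box v k (by linarith)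
    (by linarith), volume_real_box v k (by linarith) (by linarith)] at hmono
  have hRpos : 0 < R := by linarith
  have hθ : ((R - 1) / R) ^ (n - 1) = (2 * (R - 1)) ^ (n - 1) / (2 * R) ^ (n - 1) := by
    rw [← div_pow, mul_div_mul_left _ _ two_ne_zero]
  have hD : 0 < (2 * R) ^ (n - 1) := by positivity
  rw [hθ]
  -- Dividing by the volume of `Q`, which is `D / (t (1 - t))`, normalises the inequality.
  generalize (2 * R) ^ (n - 1) = D at hmono hD ⊢
  generalize (2 * (R - 1)) ^ (n - 1) = P at hmono ⊢
  have heq : (t * (α - C) + (1 - t) * (β - C)) * (P / D) + C = t * (1 - t) / D *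
      ((0 - -(1 / (1 - t))) * P * (α - C) + (1 / t - 0) * P * (β - C) +
        (1 / t - -(1 / (1 - t))) * D * C) := by
    field_simp
    ring
  rw [heq]
  exact mul_nonneg (by positivity) hmono

/-- Rank-one convexity: with the rank-one matrix `a ⊗ vₖ`, the two matrices on the right are
`F + (1 - t) a ⊗ vₖ` and `F - t a ⊗ vₖ`. -/
theorem Quasiconvex.le_laminate {w : Mat n → ℝ}
    (hw : Quasiconvex (fun A => (w A : EReal))) (a : E n) (F : Mat n) (ht0 : 0 < t) (ht1 : t < 1) :
    w F ≤ t * w (F + rankOne a (laminateLin v k t (k, true))) +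
      (1 - t) * w (F + rankOne a (laminateLin v k t (k, false))) := by
  obtain ⟨C, hC⟩ := Quasiconvex.laminate_inequality v k hw a F ht0 ht1
  have hlim1 : Tendsto (fun R : ℝ => (R - 1) / R) atTop (𝓝 1) := by
    have h : Tendsto (fun R : ℝ => 1 - R⁻¹) atTop (𝓝 (1 - 0)) :=
      tendsto_const_nhds.sub tendsto_inv_atTop_zero
    rw [sub_zero] at h
    refine h.congr' ((eventually_ne_atTop 0).mono fun R hR => ?_)
    field_simp
  have hlim := ((hlim1.pow (n - 1)).const_mul
    (t * (w (F + rankOne a (laminateLin v k t (k, true))) - w F - C) +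
      (1 - t) * (w (F + rankOne a (laminateLin v k t (k, false))) - w F - C))).add_const C
  have := ge_of_tendsto hlim ((eventually_ge_atTop 1).mono hC)
  rw [one_pow] at this
  linarith

end

/-! ### The upper bound -/

theorem svdMat_update (u v : OrthonormalBasis (Fin n) ℝ (E n)) (c : Fin n → ℝ) (k : Fin n)
    {t d : ℝ} {b : Bool} (hd : d = c k + 2 * laminateSlope k t (k, b)) :
    svdMat u v c + rankOne ((2 : ℝ) • u k) (laminateLin v k t (k, b))
      = svdMat u v (Function.update c k d) := by
  ext i j
  have h1 (l : Fin n) : Function.update c k d l * u l i * v l j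
      = c l * u l i * v l j + if l = k then (d - c k) * u k i * v k j else 0 := by
    by_cases h : l = k
    · subst h; simp; ring
    · simp [h]
  simp only [Matrix.add_apply, svdMat_apply, h1, Finset.sum_add_distrib, Finset.sum_ite_eq',
    Finset.mem_univ, if_true, rankOne, Matrix.of_apply, laminateLin_apply]
  simp only [EuclideanSpace.inner_single_right, PiLp.smul_apply, smul_eq_mul, hd]
  simp
  ring

/-- Every signed singular value in `(-1, 1)` can be replaced by `±1` along a rank-one segment, and
once no such value is left the bound is the energy itself. -/
theorem Quasiconvex.svdMat_le {w : Mat n → ℝ}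
    (hw : Quasiconvex (fun A => (w A : EReal))) (hle : ∀ A, w A ≤ biotEnergy A)
    (u v : OrthonormalBasis (Fin n) ℝ (E n)) (c : Fin n → ℝ) :
    w (svdMat u v c) ≤ ∑ k, (max (|c k| - 1) 0) ^ 2 := by
  induction hm : (Finset.univ.filter fun k => |c k| < 1).card using Nat.strong_induction_on
    generalizing c with
  | _ m ih =>
  by_cases hex : ∃ k, |c k| < 1
  · obtain ⟨k, hk⟩ := hex
    have hk' := abs_lt.1 hk
    -- `cₖ = t · 1 + (1 - t) · (-1)`
    set t : ℝ := (1 + c k) / 2 with ht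
    have ht0 : 0 < t := by linarith
    have ht1 : t < 1 := by linarith
    have hstep (d : ℝ) (hd : |d| = 1) :
        w (svdMat u v (Function.update c k d)) ≤ ∑ k, (max (|c k| - 1) 0) ^ 2 := by
      have hcard : (Finset.univ.filter fun l => |Function.update c k d l| < 1).card < m := by
        rw [← hm]
        refine Finset.card_lt_card (Finset.ssubset_iff_of_subset ?_ |>.2 ⟨k, by simpa using hk, ?_⟩)
        · intro l hl
          rcases eq_or_ne l k with rfl | hlk
          · simpa using hk
          · simpa [hlk] using hl
        · simp [hd]
      refine (ih _ hcard _ rfl).trans_eq (Finset.sum_congr rfl fun l _ => ?_)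
      rcases eq_or_ne l k with rfl | hlk
      · rw [Function.update_self, hd, max_eq_right (by linarith : |c l| - 1 ≤ 0)]
        simp
      · rw [Function.update_of_ne hlk]
    have hmain := Quasiconvex.le_laminate v k hw ((2 : ℝ) • u k) (svdMat u v c) ht0 ht1
    rw [svdMat_update u v c k (d := 1) (by simp only [laminateSlope, if_true]; linarith),
      svdMat_update u v c k (d := -1) (by
        simp only [laminateSlope, if_true, Bool.false_eq_true, if_false]; linarith)] at hmain
    refine hmain.trans ?_
    have h1 := mul_le_mul_of_nonneg_left (hstep 1 (by simp)) ht0.le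
    have h2 := mul_le_mul_of_nonneg_left (hstep (-1) (by simp)) (sub_nonneg.2 ht1.le)
    linarith
  · push Not at hex
    refine (hle _).trans_eq ?_
    rw [biotEnergy_svdMat]
    exact Finset.sum_congr rfl fun k _ => by rw [max_eq_left (by linarith [hex k])]

end BiotEnvelope

end

theorem mainTheorem3 (n : ℕ) (F : BiotEnvelope.Mat n) :
    BiotEnvelope.quasiconvexEnvelope (n := n) BiotEnvelope.biotEnergy F =
      ((∑ k : Fin n, (max (BiotEnvelope.singularValue F k - 1) 0) ^ 2 : ℝ) : EReal) := by
  open BiotEnvelope in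
  refine le_antisymm (sSup_le ?_) (le_sSup ?_)
  · rintro y ⟨w, hbot, hw, hle, rfl⟩
    -- `w` is real-valued, being bounded above by the energy
    have hcoe (A : Mat n) : ((w A).toReal : EReal) = w A :=
      EReal.coe_toReal (ne_top_of_le_ne_top (EReal.coe_ne_top _) (hle A)) (hbot A)
    have hw' : Quasiconvex (fun A => ((w A).toReal : EReal)) := by simpa only [hcoe] using hw
    obtain ⟨u, v, hF⟩ := exists_eq_svdMat F
    have h := Quasiconvex.svdMat_le hw'
      (fun A => EReal.coe_le_coe_iff.1 ((hcoe A).trans_le (hle A))) u v (singularValue F)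
    rw [← hF] at h
    simp only [abs_of_nonneg (singularValue_nonneg F _)] at h
    rw [← hcoe F]
    exact_mod_cast h
  · exact ⟨fun A => (relaxedEnergy A : EReal), fun A => EReal.coe_ne_bot _,
      quasiconvex_of_exists_subgradient relaxedEnergy_nonneg exists_subgradient_relaxedEnergy,
      fun A => EReal.coe_le_coe_iff.2 (relaxedEnergy_le_biotEnergy A), rfl⟩
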